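/- Let $\mathcal G=\langle\mathcal V,\mathcal E\rangle$ be a finite graph (directed edges and loops are allowed; an undirected graph is the case of a symmetric adjacency relation) in which every vertex $v$ has a nonempty set $\mathrm{adj}(v)$ of (out-)neighbours. Let $N$ be the number of pursuing units, $\gamma\in[0,1)$ a discount factor, $t\ge 0$ an integer (the horizon) and $s_p^0\in\mathcal V^N$ an initial position of the pursuer. For a position $p=(p_1,\dots,p_N)\in\mathcal V^N$ put $\mathrm{adj}(p)=\mathrm{adj}(p_1)\times\cdots\times\mathrm{adj}(p_N)$, and write $v\in p$ if $v=p_i$ for some $i$. For a probability distribution $b^0\in\Delta(\mathcal V)$ (the initial belief), the two-player zero-sum extensive-form game $G^t\langle s_p^0,b^0\rangle$ is defined as follows. Chance draws the evader's initial vertex $s_e^0$ from $b^0$. As long as the evader is not captured and fewer than $t$ rounds have been played, in round $\tau+1$ the pursuer chooses $s_p^{\tau+1}\in\mathrm{adj}(s_p^\tau)$ and the evader simultaneously chooses $s_e^{\tau+1}\in\mathrm{adj}(s_e^\tau)$. The game ends at the history $s_e^0s_p^1s_e^1\cdots s_p^\tau s_e^\tau$ if $s_e^\tau\in s_p^\tau$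 (the evader is captured; the pursuer's utility is $\gamma^\tau$, with $\gamma^0=1$), or if $\tau=t$ and the evader is not captured (the pursuer's utility is $0$). The evader's utility is the negative of the pursuer's. A behavioral strategy of the pursuer assigns to each sequence $s_p^1\cdots s_p^\tau$ of his own past actions (which is all that he observes while the game continues) a probability distribution on $\mathrm{adj}(s_p^\tau)$. A behavioral strategy of the evader assigns to each history $s_e^0s_p^1s_e^1\cdots s_p^\tau s_e^\tau$ a probability distribution on $\mathrm{adj}(s_e^\tau)$. A Nash equilibrium is a pair of behavioral strategies each of which is a best response to the other with respect to expected utility. Theorem. There exists a finite set $\Sigma^t\langle s_p^0\rangle$ of behavioral strategies of the pursuer, not depending on the belief, such that for every initial belief $b^0\in\Delta(\mathcal V)$ there are a strategy $\sigma_p\in\Sigma^t\langle s_p^0\rangle$ and a behavioral strategy $\sigma_e$ of the evader for which $(\sigma_p,\sigma_e)$ is a Nash equilibrium of $G^t\langle s_p^0,b^0\rangle$. -/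

import Mathlib

namespace PursuitEvasion

/-- A joint position of the `N` pursuing units. -/
abbrev Pos (V : Type*) (N : ℕ) := Fin N → V

/-- A node `s_e⁰ s_p¹ s_e¹ ⋯ s_p^τ s_e^τ` at the end of a round: `start s_e⁰`, followed by one
`round` for each pair of simultaneous moves. Whether the moves are legal is decided by
`histories` below. -/
inductive History (V : Type*) (N : ℕ) where
  | start (s : V) : History V N
  | round (h : History V N) (p : Pos V N) (e : V) : History V N

namespace History

variable {V : Type*} {N : ℕ}

/-- The number `τ` of rounds played. -/
def rounds : History V N → ℕ
  | start _ => 0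
  | round h _ _ => h.rounds + 1

/-- The initial position `s_e⁰` of the evader. -/
def init : History V N → V
  | start s => s
  | round h _ _ => h.init

/-- The current position `s_e^τ` of the evader. -/
def evaderPos : History V N → V
  | start s => s
  | round _ _ e => e

/-- The sequence of the pursuer's actions, **most recent first**: `[s_p^τ, …, s_p¹]`. -/
def pursuerSeq : History V N → List (Pos V N)
  | start _ => []
  | round h p _ => p :: h.pursuerSeq

/-- The current position `s_p^τ` of the pursuer, who started in `s₀`. -/
def pursuerPos (s₀ : Pos V N) (h : History V N) : Pos V N := h.pursuerSeq.headD s₀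

/-- The evader stands on a vertex occupied by one of the pursuing units. -/
def Captured (s₀ : Pos V N) (h : History V N) : Prop := ∃ i, h.pursuerPos s₀ i = h.evaderPos

end History

section Game

variable {V : Type*} [Fintype V] {N : ℕ}

/-- Vertices the evader can move to from `v`. -/
noncomputable def evaderMoves (G : Digraph V) (v : V) : Finset V :=
  open Classical in Finset.univ.filter fun w => G.Adj v w

/-- Joint positions the pursuer can move to from `p`: the product of the neighbourhoods. -/
noncomputable def pursuerMoves (G : Digraph V) (p : Pos V N) : Finset (Pos V N) :=
  open Classical in Finset.univ.filter fun q => ∀ i, G.Adj (p i) (q i)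

/-- The histories of the game with exactly `τ` completed rounds: any evader's initial position,
then legal moves of both players, continued only as long as the evader has not been captured. -/
noncomputable def histories (G : Digraph V) (s₀ : Pos V N) : ℕ → Finset (History V N)
  | 0 => open Classical in Finset.univ.image History.start
  | τ + 1 => open Classical in
      ((histories G s₀ τ).filter fun h => ¬ h.Captured s₀).biUnion fun h =>
        (pursuerMoves G (h.pursuerPos s₀) ×ˢ evaderMoves G h.evaderPos).image
          fun m => h.round m.1 m.2

/-- The terminal histories of the horizon-`t` game. -/
noncomputable def terminals (G : Digraph V) (t : ℕ) (s₀ : Pos V N) : Finset (History V N) :=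
  open Classical in
    ((Finset.range (t + 1)).biUnion (histories G s₀)).filter
      fun h => h.Captured s₀ ∨ h.rounds = t

/-- The pursuer's utility of a terminal history. -/
noncomputable def utility (γ : ℝ) (s₀ : Pos V N) (h : History V N) : ℝ :=
  open Classical in if h.Captured s₀ then γ ^ h.rounds else 0

/-- A behavioral strategy of the pursuer who starts in `s₀`. The information sets of the pursuer
are labelled by his own sequences of actions (most recent first); at each of them the strategy
gives a distribution over the legal joint moves. It is convenient to let the strategy be defined
on all sequences; its values on sequences that label no information set of the horizon-`t` game
do not enter the expected utility of that game. -/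
structure PursuerStrategy (G : Digraph V) (s₀ : Pos V N) where
  prob : List (Pos V N) → Pos V N → ℝ
  prob_mem : ∀ l, prob l ∈ stdSimplex ℝ (Pos V N)
  legal : ∀ l p, p ∉ pursuerMoves G (l.headD s₀) → prob l p = 0

/-- A behavioral strategy of the evader. Her information sets
`{h s_p^{τ+1} | s_p^{τ+1} a legal pursuer's move}` are labelled by the histories `h`; at each of
them the strategy gives a distribution over her legal moves. As above, values at labels that do
not occur in the game are irrelevant. -/
structure EvaderStrategy (G : Digraph V) (N : ℕ) where
  prob : History V N → V → ℝ
  prob_mem : ∀ h, prob h ∈ stdSimplex ℝ V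
  legal : ∀ h e, e ∉ evaderMoves G h.evaderPos → prob h e = 0

variable {G : Digraph V} {s₀ : Pos V N}

/-- The probability that the pursuer's strategy plays all his actions in `h`. -/
def PursuerStrategy.reach (σ : PursuerStrategy G s₀) : History V N → ℝ
  | .start _ => 1
  | .round h p _ => σ.reach h * σ.prob h.pursuerSeq p

/-- The probability that the evader's strategy plays all her actions in `h`. -/
def EvaderStrategy.reach (ρ : EvaderStrategy G N) : History V N → ℝ
  | .start _ => 1
  | .round h _ e => ρ.reach h * ρ.prob h e

/-- The pursuer's expected utility in the horizon-`t` game with initial belief `b`. -/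
noncomputable def expectedUtility (γ : ℝ) (t : ℕ) (b : V → ℝ)
    (σ : PursuerStrategy G s₀) (ρ : EvaderStrategy G N) : ℝ :=
  ∑ h ∈ terminals G t s₀, b h.init * σ.reach h * ρ.reach h * utility γ s₀ h

/-- Nash equilibrium of the (zero-sum) horizon-`t` game with initial belief `b`: the pursuer
maximizes and the evader minimizes the pursuer's expected utility. -/
def IsNash (γ : ℝ) (t : ℕ) (b : V → ℝ)
    (σ : PursuerStrategy G s₀) (ρ : EvaderStrategy G N) : Prop :=
  (∀ σ' : PursuerStrategy G s₀, expectedUtility γ t b σ' ρ ≤ expectedUtility γ t b σ ρ) ∧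
  (∀ ρ' : EvaderStrategy G N, expectedUtility γ t b σ ρ ≤ expectedUtility γ t b σ ρ')

end Game

end PursuitEvasion

/-! In sequence form, behavioral strategies of each player become points of a polytope of
realization plans, and the payoff from each initial evader vertex `v` is bilinear in the two plans;
the belief only weights these payoffs. The evader sees `v`, so she can combine separate best replies
for all `v`, and a plan `x` guarantees the pursuer `∑ v, b v * min_y U v x y`.

For each assignment `c` of an extreme evader plan to every vertex, the plans `x` to which `c` is a
best reply form a polytope that does not depend on the belief. Finitely many such polytopes cover
the pursuer's plans. On each of them the guarantee is linear in `x` for every `b`, so it is maximal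
at an extreme point. The union of all their extreme points is therefore a finite set containing an
optimal plan for every belief (`exists_finite_isSaddlePointOn`, with Sion's minimax theorem
supplying equilibria). -/

section Polyhedron

/-! ### Polyhedra, extreme points and parametrized bilinear games. -/

variable {E : Type*} [AddCommGroup E] [Module ℝ E]

/-- The polyhedron cut out of an affine subspace by linear inequalities `0 ≤ a i x`. -/
def polyhedron (L : AffineSubspace ℝ E) {ι : Type*} (a : ι → E →ₗ[ℝ] ℝ) : Set E :=
  {x | x ∈ L ∧ ∀ i, 0 ≤ a i x}

theorem convex_polyhedron (L : AffineSubspace ℝ E) {ι : Type*} (a : ι → E →ₗ[ℝ] ℝ) :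
    Convex ℝ (polyhedron L a) := by
  intro x hx y hy s r hs hr hsr
  refine ⟨L.convex hx.1 hy.1 hs hr hsr, fun i => ?_⟩
  simp only [map_add, map_smul, smul_eq_mul]
  have := mul_nonneg hs (hx.2 i)
  have := mul_nonneg hr (hy.2 i)
  linarith

/-- Two extreme points of a polyhedron with the same active constraints coincide. -/
theorem eq_of_active_eq {L : AffineSubspace ℝ E} {ι : Type*} [Finite ι] {a : ι → E →ₗ[ℝ] ℝ}
    {x y : E} (hx : x ∈ (polyhedron L a).extremePoints ℝ) (hy : y ∈ polyhedron L a)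
    (hxy : ∀ i, a i x = 0 → a i y = 0) : y = x := by
  -- `x` can be pushed slightly away from `y`: active constraints stay at zero and the others have
  -- slack. This puts `x` strictly between `y` and the new point.
  have hsmall : ∃ ε : ℝ, 0 < ε ∧ ∀ i, 0 ≤ a i x + ε * (a i x - a i y) := by
    have hev : ∀ᶠ ε : ℝ in nhdsWithin 0 (Set.Ioi 0), ∀ i, 0 ≤ a i x + ε * (a i x - a i y) := by
      rw [Filter.eventually_all]
      intro i
      rcases (hx.1.2 i).eq_or_lt with h | h
      · simp [← h, hxy i h.symm]
      · have hc : Continuous fun ε : ℝ => a i x + ε * (a i x - a i y) := by fun_prop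
        have : ∀ᶠ ε : ℝ in nhds 0, 0 < a i x + ε * (a i x - a i y) :=
          hc.continuousAt.eventually (lt_mem_nhds (by simpa using h))
        exact (this.filter_mono nhdsWithin_le_nhds).mono fun _ => le_of_lt
    obtain ⟨ε, h, hε⟩ := (hev.and self_mem_nhdsWithin).exists
    exact ⟨ε, hε, h⟩
  obtain ⟨ε, hε, h⟩ := hsmall
  have hz : x + ε • (x - y) ∈ polyhedron L a := by
    refine ⟨?_, fun i => by simpa using h i⟩
    have := L.smul_vsub_vadd_mem ε hx.1.1 hy.1 hx.1.1
    simpa [add_comm] using this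
  refine hx.2 hy hz ⟨ε / (1 + ε), 1 / (1 + ε), by positivity, by positivity, by field_simp; ring, ?_⟩
  have : (1 + ε) ≠ 0 := by positivity
  apply smul_right_injective E this
  simp only [smul_add, smul_smul, smul_sub]
  have e1 : (1 + ε) * (ε / (1 + ε)) = ε := by field_simp
  have e2 : (1 + ε) * (1 / (1 + ε)) = 1 := by field_simp
  have e3 : (1 + ε) * (1 / (1 + ε) * ε) = ε := by field_simp
  rw [e1, e2, e3]
  module

/-- An extreme point is determined by its set of active inequalities. Only the inequalities must be
finite in number, not the equations defining `L` or the dimension. -/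
theorem finite_extremePoints_polyhedron (L : AffineSubspace ℝ E) {ι : Type*} [Finite ι]
    (a : ι → E →ₗ[ℝ] ℝ) : ((polyhedron L a).extremePoints ℝ).Finite := by
  refine Set.Finite.of_finite_image (f := fun x => {i | a i x = 0}) (Set.toFinite _) ?_
  intro x hx y hy hxy
  refine (eq_of_active_eq hx hy.1 fun i hi => ?_).symm
  have : i ∈ {i | a i x = 0} := hi
  simp only at hxy
  rwa [hxy] at this

variable [TopologicalSpace E] [IsTopologicalAddGroup E] [ContinuousSMul ℝ E] [T2Space E]
  [LocallyConvexSpace ℝ E]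

/-- The maximizers form a compact exposed face; its extreme points, which exist by Krein–Milman, are
extreme in `s`. -/
theorem IsCompact.exists_extremePoint_isMaxOn {s : Set E} (hs : IsCompact s) (hne : s.Nonempty)
    (f : E →L[ℝ] ℝ) : ∃ x ∈ s.extremePoints ℝ, ∀ y ∈ s, f y ≤ f x := by
  have hexp := ContinuousLinearMap.toExposed.isExposed (l := f) (A := s)
  obtain ⟨x, hx, hmax⟩ := hs.exists_isMaxOn hne f.continuous.continuousOn
  obtain ⟨z, hz⟩ := (hexp.isCompact hs).extremePoints_nonempty ⟨x, hx, hmax⟩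
  exact ⟨z, hexp.isExtreme.extremePoints_subset_extremePoints hz, hz.1.2⟩

/-- In a family of bilinear games on polytopes, indexed by a state `v`, in which the minimizer can
combine state-dependent choices into a single one, the maximizer has a finite set of strategies
which contains an optimal one for every nonnegative weighting of the states. -/
theorem exists_finite_isSaddlePointOn
    {F : Type*} [AddCommGroup F] [Module ℝ F] [TopologicalSpace F] [IsTopologicalAddGroup F]
    [ContinuousSMul ℝ F] [T2Space F] [LocallyConvexSpace ℝ F]
    {V : Type*} [Fintype V]
    (L : AffineSubspace ℝ E) {ι : Type*} [Finite ι] (a : ι → E →ₗ[ℝ] ℝ)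
    (hX : IsCompact (polyhedron L a)) (hXne : (polyhedron L a).Nonempty)
    (M : AffineSubspace ℝ F) {κ : Type*} [Finite κ] (d : κ → F →ₗ[ℝ] ℝ)
    (hY : IsCompact (polyhedron M d)) (hYne : (polyhedron M d).Nonempty)
    (U : V → E →ₗ[ℝ] F →ₗ[ℝ] ℝ) (hUx : ∀ v x, Continuous fun y => U v x y)
    (hUy : ∀ v y, Continuous fun x => U v x y)
    (hglue : ∀ c : V → F, (∀ v, c v ∈ polyhedron M d) →
      ∃ z ∈ polyhedron M d, ∀ v x, U v x z = U v x (c v)) :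
    ∃ S ⊆ polyhedron L a, S.Finite ∧ ∀ b : V → ℝ, (∀ v, 0 ≤ b v) →
      ∃ x ∈ S, ∃ y ∈ polyhedron M d,
        (∀ x' ∈ polyhedron L a, ∑ v, b v * U v x' y ≤ ∑ v, b v * U v x y) ∧
        ∀ y' ∈ polyhedron M d, ∑ v, b v * U v x y ≤ ∑ v, b v * U v x y' := by
  set X := polyhedron L a with hXdef
  set Y := polyhedron M d with hYdef
  have hYfin : (Y.extremePoints ℝ).Finite := finite_extremePoints_polyhedron M d
  have : Finite (Y.extremePoints ℝ) := hYfin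
  -- the region on which the choice `c` is optimal for the minimizer in every state
  let A (c : V → Y.extremePoints ℝ) : ι ⊕ (V × Y.extremePoints ℝ) → E →ₗ[ℝ] ℝ :=
    Sum.elim a fun q => (U q.1).flip q.2 - (U q.1).flip (c q.1)
  have hmem (c : V → Y.extremePoints ℝ) (x : E) : x ∈ polyhedron L (A c) ↔
      x ∈ X ∧ ∀ v, ∀ y ∈ Y.extremePoints ℝ, U v x (c v) ≤ U v x y := by
    simp [A, X, polyhedron, and_assoc]
  have hcompact (c : V → Y.extremePoints ℝ) : IsCompact (polyhedron L (A c)) := by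
    have hset : polyhedron L (A c) =
        X ∩ {x | ∀ v, ∀ y ∈ Y.extremePoints ℝ, U v x (c v) ≤ U v x y} := by
      ext x; exact hmem c x
    rw [hset]
    refine hX.inter_right ?_
    simp only [Set.ofPred_forall]
    exact isClosed_iInter fun v => isClosed_iInter fun y => isClosed_iInter fun _ =>
      isClosed_le (hUy v _) (hUy v _)
  have hbest (v : V) (x : E) : ∃ y ∈ Y.extremePoints ℝ, ∀ y' ∈ Y, U v x y ≤ U v x y' := by
    obtain ⟨y, hy, h⟩ := hY.exists_extremePoint_isMaxOn hYne (-(⟨U v x, hUx v x⟩ : F →L[ℝ] ℝ))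
    exact ⟨y, hy, fun y' hy' => by simpa using h y' hy'⟩
  have hregion (c : V → Y.extremePoints ℝ) {x : E} (hx : x ∈ polyhedron L (A c)) (v : V) {y : F}
      (hy : y ∈ Y) : U v x (c v) ≤ U v x y := by
    obtain ⟨y₀, hy₀, h⟩ := hbest v x
    exact (((hmem c x).1 hx).2 v y₀ hy₀).trans (h y hy)
  refine ⟨⋃ c, (polyhedron L (A c)).extremePoints ℝ, ?_, ?_, ?_⟩
  · exact Set.iUnion_subset fun c x hx => ((hmem c x).1 hx.1).1
  · exact Set.finite_iUnion fun c => finite_extremePoints_polyhedron L (A c)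
  intro b hb
  let B : E →ₗ[ℝ] F →ₗ[ℝ] ℝ := ∑ v, b v • U v
  have hB (x : E) (y : F) : B x y = ∑ v, b v * U v x y := by simp [B]
  have hBx (x : E) : Continuous fun y => B x y := by
    simp only [hB]; exact continuous_finsetSum _ fun v _ => (hUx v x).const_mul _
  have hBy (y : F) : Continuous fun x => B x y := by
    simp only [hB]; exact continuous_finsetSum _ fun v _ => (hUy v y).const_mul _
  -- This `x` depends on `b` and need not lie in the finite set; it only fixes the value and selects
  -- a region `c`.
  obtain ⟨y, hy, x, hx, hsaddle⟩ := Sion.exists_isSaddlePointOn (X := Y) (Y := X)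
    (f := fun y x => B x y) hYne (convex_polyhedron M d) hY
    (fun x _ => (hBx x).lowerSemicontinuous.lowerSemicontinuousOn _)
    (fun x _ => ((B x).convexOn (convex_polyhedron M d)).quasiconvexOn)
    (convex_polyhedron L a) hXne hX
    (fun y _ => (hBy y).upperSemicontinuous.upperSemicontinuousOn _)
    (fun y _ => ((B.flip y).concaveOn (convex_polyhedron L a)).quasiconcaveOn)
  choose c₀ hc₀ hc₀min using fun v => hbest v x
  let c (v : V) : Y.extremePoints ℝ := ⟨c₀ v, hc₀ v⟩
  have hxc : x ∈ polyhedron L (A c) := (hmem c x).2 ⟨hx, fun v y hy => hc₀min v y hy.1⟩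
  -- On the region of `c`, `f` is the amount that a plan guarantees under the belief `b`.
  let f : E →L[ℝ] ℝ := ⟨∑ v, b v • (U v).flip (c v),
    (continuous_finsetSum Finset.univ fun v _ => (hUy v (c v)).const_mul (b v)).congr
      fun z => by simp⟩
  have hf (z : E) : f z = ∑ v, b v * U v z (c v) := by simp [f]
  obtain ⟨x', hx', hmax⟩ := (hcompact c).exists_extremePoint_isMaxOn ⟨x, hxc⟩ f
  obtain ⟨z, hz, hzc⟩ := hglue (fun v => c v) fun v => (hc₀ v).1
  have hx'X : x' ∈ X := ((hmem c x').1 hx'.1).1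
  -- The glued reply `z` cannot beat `y` against `x`, so the value of the game is at most `f x`.
  have hval : B x y ≤ f x' := calc
    B x y ≤ B x z := hsaddle z hz x hx
    _ = f x := by simp only [hB, hf, hzc]
    _ ≤ f x' := hmax x hxc
  have hlow (y' : F) (hy' : y' ∈ Y) : f x' ≤ B x' y' := by
    rw [hB, hf]
    exact Finset.sum_le_sum fun v _ => mul_le_mul_of_nonneg_left (hregion c hx'.1 v hy') (hb v)
  simp only [← hB]
  -- Both conditions follow from `B w y ≤ B x y ≤ f x' ≤ B x' y'` and `B x' y ≤ B x y`.
  refine ⟨x', Set.mem_iUnion.2 ⟨c, hx'⟩, y, hy, fun w hw => ?_, fun y' hy' => ?_⟩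
  · exact (hsaddle y hy w hw).trans (hval.trans (hlow y hy))
  · exact (hsaddle y hy x' hx'X).trans (hval.trans (hlow y' hy'))

end Polyhedron

/-- A nonnegative vector supported on a nonempty set is a multiple of a probability distribution
supported on that set. -/
theorem exists_stdSimplex_sum_mul_eq {A : Type*} [Fintype A] {m : A → ℝ} (hm : ∀ a, 0 ≤ m a)
    {s : Finset A} (hs : s.Nonempty) (hms : ∀ a, a ∉ s → m a = 0) :
    ∃ q ∈ stdSimplex ℝ A, (∀ a, a ∉ s → q a = 0) ∧ ∀ a, (∑ a', m a') * q a = m a := by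
  classical
  -- With zero total mass any distribution on `s` works, here a point mass.
  rcases (Finset.sum_nonneg fun a _ => hm a : 0 ≤ ∑ a, m a).eq_or_lt with h | h
  · obtain ⟨a₀, ha₀⟩ := hs
    refine ⟨Pi.single a₀ 1, single_mem_stdSimplex ℝ a₀, fun a ha => ?_, fun a => ?_⟩
    · exact Pi.single_eq_of_ne (fun e => ha (by rwa [e])) _
    · have := (Finset.sum_eq_zero_iff_of_nonneg fun a _ => hm a).1 h.symm a (Finset.mem_univ a)
      rw [← h, this, zero_mul]
  · refine ⟨fun a => m a / ∑ a', m a', ⟨fun a => div_nonneg (hm a) h.le, ?_⟩, fun a ha => ?_,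
      fun a => ?_⟩
    · rw [← Finset.sum_div, div_self h.ne']
    · simp [hms a ha]
    · field_simp

/-! ### Finiteness up to the horizon and existence of strategies. -/

namespace PursuitEvasion

variable {V : Type*} {N : ℕ}

theorem History.length_pursuerSeq (h : History V N) : h.pursuerSeq.length = h.rounds := by
  induction h with
  | start s => rfl
  | round h p e ih => simp [History.pursuerSeq, History.rounds, ih]

variable [Fintype V]

/-- Makes the family of inequalities defining the evader's plans finite. -/
theorem History.finite_rounds_le (t : ℕ) : {h : History V N | h.rounds ≤ t}.Finite := by
  induction t with
  | zero =>
    refine (Set.finite_range (History.start : V → History V N)).subset fun h hh => ?_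
    cases h with
    | start s => exact ⟨s, rfl⟩
    | round h p e => simp [History.rounds] at hh
  | succ t ih =>
    have : Finite {h : History V N | h.rounds ≤ t} := ih
    refine ((Set.finite_range (History.start : V → History V N)).union
      (Set.finite_range fun q : {h : History V N | h.rounds ≤ t} × Pos V N × V =>
        q.1.1.round q.2.1 q.2.2)).subset fun h hh => ?_
    cases h with
    | start s => exact Or.inl ⟨s, rfl⟩
    | round h p e => exact Or.inr ⟨(⟨h, Nat.le_of_succ_le_succ hh⟩, p, e), rfl⟩

theorem rounds_of_mem_histories {G : Digraph V} {s₀ : Pos V N} {τ : ℕ} {h : History V N}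
    (hh : h ∈ histories G s₀ τ) : h.rounds = τ := by
  classical
  induction τ generalizing h with
  | zero =>
    simp only [histories, Finset.mem_image] at hh
    obtain ⟨s, -, rfl⟩ := hh
    rfl
  | succ τ ih =>
    simp only [histories, Finset.mem_biUnion, Finset.mem_image, Finset.mem_filter] at hh
    obtain ⟨h', hh', m, -, rfl⟩ := hh
    simp [History.rounds, ih hh'.1]

theorem rounds_le_of_mem_terminals {G : Digraph V} {t : ℕ} {s₀ : Pos V N} {h : History V N}
    (hh : h ∈ terminals G t s₀) : h.rounds ≤ t := by
  simp only [terminals, Finset.mem_filter, Finset.mem_biUnion, Finset.mem_range] at hh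
  obtain ⟨⟨τ, hτ, hh⟩, -⟩ := hh
  rw [rounds_of_mem_histories hh]
  omega

theorem evaderMoves_nonempty {G : Digraph V} (hG : ∀ v, ∃ w, G.Adj v w) (v : V) :
    (evaderMoves G v).Nonempty := by
  obtain ⟨w, hw⟩ := hG v
  exact ⟨w, by simp [evaderMoves, hw]⟩

theorem pursuerMoves_nonempty {G : Digraph V} (hG : ∀ v, ∃ w, G.Adj v w) (p : Pos V N) :
    (pursuerMoves G p).Nonempty := by
  choose f hf using hG
  exact ⟨fun i => f (p i), by simp [pursuerMoves, hf]⟩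

theorem nonempty_pursuerStrategy {G : Digraph V} (hG : ∀ v, ∃ w, G.Adj v w) (s₀ : Pos V N) :
    Nonempty (PursuerStrategy G s₀) := by
  choose q hq hlegal _ using fun l : List (Pos V N) =>
    exists_stdSimplex_sum_mul_eq (m := 0) (fun _ => le_rfl)
      (pursuerMoves_nonempty hG (l.headD s₀)) fun _ _ => rfl
  exact ⟨⟨q, hq, hlegal⟩⟩

theorem nonempty_evaderStrategy {G : Digraph V} (hG : ∀ v, ∃ w, G.Adj v w) :
    Nonempty (EvaderStrategy G N) := by
  choose q hq hlegal _ using fun h : History V N =>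
    exists_stdSimplex_sum_mul_eq (m := 0) (fun _ => le_rfl)
      (evaderMoves_nonempty hG h.evaderPos) fun _ _ => rfl
  exact ⟨⟨q, hq, hlegal⟩⟩

/-! ### Realization plans of the pursuer -/

/-- The affine constraints on a realization plan of the pursuer in the horizon-`t` game, which
gives to each sequence of his actions the probability that his strategy plays it. -/
def pursuerPlanSpace (G : Digraph V) (t : ℕ) (s₀ : Pos V N) :
    AffineSubspace ℝ (List (Pos V N) → ℝ) where
  -- Vanishing beyond the horizon bounds the coordinates that no other constraint controls, as
  -- compactness requires.
  carrier := {x | x [] = 1 ∧ (∀ l, t < l.length → x l = 0) ∧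
    (∀ l, l.length < t → ∑ p, x (p :: l) = x l) ∧
    ∀ l p, p ∉ pursuerMoves G (l.headD s₀) → x (p :: l) = 0}
  smul_vsub_vadd_mem' := by
    rintro c x y z ⟨hx₁, hx₂, hx₃, hx₄⟩ ⟨hy₁, hy₂, hy₃, hy₄⟩ ⟨hz₁, hz₂, hz₃, hz₄⟩
    refine ⟨by simp [hx₁, hy₁, hz₁], fun l hl => by simp [hx₂ l hl, hy₂ l hl, hz₂ l hl],
      fun l hl => ?_, fun l p hp => by simp [hx₄ l p hp, hy₄ l p hp, hz₄ l p hp]⟩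
    simp [Finset.sum_add_distrib, ← Finset.mul_sum, hx₃ l hl, hy₃ l hl, hz₃ l hl]

/-- The realization plans of the pursuer in the horizon-`t` game. -/
def pursuerPlans (G : Digraph V) (t : ℕ) (s₀ : Pos V N) : Set (List (Pos V N) → ℝ) :=
  polyhedron (pursuerPlanSpace G t s₀)
    fun l : {l : List (Pos V N) // l.length ≤ t} => LinearMap.proj l.1

variable {G : Digraph V} {t : ℕ} {s₀ : Pos V N}

theorem pursuerPlans_nonneg {x : List (Pos V N) → ℝ} (hx : x ∈ pursuerPlans G t s₀)
    (l : List (Pos V N)) : 0 ≤ x l := by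
  rcases le_or_gt l.length t with h | h
  · exact hx.2 ⟨l, h⟩
  · exact (hx.1.2.1 l h).ge

theorem pursuerPlans_le_one {x : List (Pos V N) → ℝ} (hx : x ∈ pursuerPlans G t s₀)
    (l : List (Pos V N)) : x l ≤ 1 := by
  induction l with
  | nil => exact hx.1.1.le
  | cons p l ih =>
    rcases lt_or_ge l.length t with h | h
    · refine le_trans ?_ ih
      rw [← hx.1.2.2.1 l h]
      exact Finset.single_le_sum (f := fun p => x (p :: l))
        (fun q _ => pursuerPlans_nonneg hx _) (Finset.mem_univ p)
    · rw [hx.1.2.1 _ (by simpa using Nat.lt_succ_of_le h)]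
      exact zero_le_one

theorem isCompact_pursuerPlans : IsCompact (pursuerPlans G t s₀) := by
  refine (isCompact_univ_pi fun _ => isCompact_Icc (a := (0 : ℝ)) (b := 1)).of_isClosed_subset ?_
    fun x hx l _ => ⟨pursuerPlans_nonneg hx l, pursuerPlans_le_one hx l⟩
  have : pursuerPlans G t s₀ = {x | (x [] = 1 ∧ (∀ l, t < l.length → x l = 0) ∧
      (∀ l, l.length < t → ∑ p, x (p :: l) = x l) ∧
      ∀ l p, p ∉ pursuerMoves G (l.headD s₀) → x (p :: l) = 0) ∧
      ∀ l : {l : List (Pos V N) // l.length ≤ t}, 0 ≤ x l} := rfl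
  rw [this]
  simp only [Set.ofPred_and, Set.ofPred_forall]
  refine .inter (.inter ?_ (.inter ?_ (.inter ?_ ?_))) ?_
  · exact isClosed_eq (by fun_prop) (by fun_prop)
  · exact isClosed_iInter fun l => isClosed_iInter fun _ => isClosed_eq (by fun_prop) (by fun_prop)
  · exact isClosed_iInter fun l => isClosed_iInter fun _ => isClosed_eq (by fun_prop) (by fun_prop)
  · exact isClosed_iInter fun l => isClosed_iInter fun p => isClosed_iInter fun _ =>
      isClosed_eq (by fun_prop) (by fun_prop)
  · exact isClosed_iInter fun l => isClosed_le (by fun_prop) (by fun_prop)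

/-- The probability that the pursuer's strategy plays a given sequence of actions. -/
def PursuerStrategy.seqReach (σ : PursuerStrategy G s₀) : List (Pos V N) → ℝ
  | [] => 1
  | p :: l => σ.seqReach l * σ.prob l p

theorem PursuerStrategy.reach_eq_seqReach (σ : PursuerStrategy G s₀) (h : History V N) :
    σ.reach h = σ.seqReach h.pursuerSeq := by
  induction h with
  | start s => rfl
  | round h p e ih => simp [reach, History.pursuerSeq, seqReach, ih]

theorem PursuerStrategy.seqReach_nonneg (σ : PursuerStrategy G s₀) (l : List (Pos V N)) :
    0 ≤ σ.seqReach l := by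
  induction l with
  | nil => exact zero_le_one
  | cons p l ih => exact mul_nonneg ih ((σ.prob_mem l).1 p)

theorem PursuerStrategy.exists_plan (σ : PursuerStrategy G s₀) (t : ℕ) :
    ∃ x ∈ pursuerPlans G t s₀, ∀ l, l.length ≤ t → σ.seqReach l = x l := by
  refine ⟨fun l => if l.length ≤ t then σ.seqReach l else 0, ⟨⟨?_, ?_, ?_, ?_⟩, ?_⟩, ?_⟩
  · simp [seqReach]
  · intro l hl
    simp [hl.not_ge]
  · intro l hl
    simp [hl.le, Nat.succ_le_of_lt hl, seqReach, ← Finset.mul_sum, (σ.prob_mem l).2]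
  · intro l p hp
    simp [seqReach, σ.legal l p hp]
  · intro l
    simpa [l.2] using σ.seqReach_nonneg l
  · intro l hl
    simp [hl]

/-- The strategy plays the conditional probabilities `x (p :: l) / x l`, and an arbitrary legal move
where the mass is zero. -/
theorem exists_pursuerStrategy_of_plan (hG : ∀ v, ∃ w, G.Adj v w) {x : List (Pos V N) → ℝ}
    (hx : x ∈ pursuerPlans G t s₀) :
    ∃ σ : PursuerStrategy G s₀, ∀ l, l.length ≤ t → σ.seqReach l = x l := by
  choose q hq hlegal hqx using fun l : List (Pos V N) =>
    exists_stdSimplex_sum_mul_eq (m := fun p => x (p :: l)) (fun _ => pursuerPlans_nonneg hx _)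
      (pursuerMoves_nonempty hG (l.headD s₀)) (hx.1.2.2.2 l)
  refine ⟨⟨q, hq, hlegal⟩, fun l => ?_⟩
  induction l with
  | nil => exact fun _ => hx.1.1.symm
  | cons p l ih =>
    intro hl
    rw [List.length_cons] at hl
    rw [PursuerStrategy.seqReach, ih (by omega), ← hx.1.2.2.1 l (by omega)]
    exact hqx l p

/-! ### Realization plans of the evader -/

/-- The affine constraints on a realization plan of the evader in the horizon-`t` game, which
gives to each history the probability that her strategy plays all her actions in it. As she moves
simultaneously with the pursuer, this does not depend on his last move. -/
def evaderPlanSpace (G : Digraph V) (N t : ℕ) : AffineSubspace ℝ (History V N → ℝ) where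
  -- Each starting vertex carries mass one, so the plans for different starts are independent
  -- blocks.
  carrier := {y | (∀ s, y (.start s) = 1) ∧ (∀ h, t < h.rounds → y h = 0) ∧
    (∀ h p, h.rounds < t → ∑ e, y (.round h p e) = y h) ∧
    (∀ h p e, e ∉ evaderMoves G h.evaderPos → y (.round h p e) = 0) ∧
    ∀ h p q e, y (.round h p e) = y (.round h q e)}
  smul_vsub_vadd_mem' := by
    rintro c x y z ⟨hx₁, hx₂, hx₃, hx₄, hx₅⟩ ⟨hy₁, hy₂, hy₃, hy₄, hy₅⟩ ⟨hz₁, hz₂, hz₃, hz₄, hz₅⟩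
    refine ⟨fun s => by simp [hx₁, hy₁, hz₁],
      fun h hh => by simp [hx₂ h hh, hy₂ h hh, hz₂ h hh], fun h p hh => ?_,
      fun h p e he => by simp [hx₄ h p e he, hy₄ h p e he, hz₄ h p e he],
      fun h p q e => by simp [hx₅ h p q e, hy₅ h p q e, hz₅ h p q e]⟩
    simp [Finset.sum_add_distrib, ← Finset.mul_sum, hx₃ h p hh, hy₃ h p hh, hz₃ h p hh]

/-- The realization plans of the evader in the horizon-`t` game. -/
def evaderPlans (G : Digraph V) (N t : ℕ) : Set (History V N → ℝ) :=
  polyhedron (evaderPlanSpace G N t) fun h : {h : History V N // h.rounds ≤ t} =>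
    LinearMap.proj h.1

theorem evaderPlans_nonneg {y : History V N → ℝ} (hy : y ∈ evaderPlans G N t)
    (h : History V N) : 0 ≤ y h := by
  rcases le_or_gt h.rounds t with hh | hh
  · exact hy.2 ⟨h, hh⟩
  · exact (hy.1.2.1 h hh).ge

theorem evaderPlans_le_one {y : History V N → ℝ} (hy : y ∈ evaderPlans G N t)
    (h : History V N) : y h ≤ 1 := by
  induction h with
  | start s => exact (hy.1.1 s).le
  | round h p e ih =>
    rcases lt_or_ge h.rounds t with hh | hh
    · refine le_trans ?_ ih
      rw [← hy.1.2.2.1 h p hh]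
      exact Finset.single_le_sum (f := fun e => y (.round h p e))
        (fun q _ => evaderPlans_nonneg hy _) (Finset.mem_univ e)
    · rw [hy.1.2.1 (.round h p e) (Nat.lt_succ_of_le hh)]
      exact zero_le_one

theorem isCompact_evaderPlans : IsCompact (evaderPlans G N t) := by
  refine (isCompact_univ_pi fun _ => isCompact_Icc (a := (0 : ℝ)) (b := 1)).of_isClosed_subset ?_
    fun y hy h _ => ⟨evaderPlans_nonneg hy h, evaderPlans_le_one hy h⟩
  have : evaderPlans G N t = {y | ((∀ s, y (.start s) = 1) ∧ (∀ h, t < h.rounds → y h = 0) ∧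
      (∀ h p, h.rounds < t → ∑ e, y (.round h p e) = y h) ∧
      (∀ h p e, e ∉ evaderMoves G h.evaderPos → y (.round h p e) = 0) ∧
      ∀ h p q e, y (.round h p e) = y (.round h q e)) ∧
      ∀ h : {h : History V N // h.rounds ≤ t}, 0 ≤ y h} := rfl
  rw [this]
  simp only [Set.ofPred_and, Set.ofPred_forall]
  refine .inter (.inter ?_ (.inter ?_ (.inter ?_ (.inter ?_ ?_)))) ?_
  · exact isClosed_iInter fun s => isClosed_eq (by fun_prop) (by fun_prop)
  · exact isClosed_iInter fun h => isClosed_iInter fun _ => isClosed_eq (by fun_prop) (by fun_prop)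
  · exact isClosed_iInter fun h => isClosed_iInter fun p => isClosed_iInter fun _ =>
      isClosed_eq (by fun_prop) (by fun_prop)
  · exact isClosed_iInter fun h => isClosed_iInter fun p => isClosed_iInter fun e =>
      isClosed_iInter fun _ => isClosed_eq (by fun_prop) (by fun_prop)
  · exact isClosed_iInter fun h => isClosed_iInter fun p => isClosed_iInter fun q =>
      isClosed_iInter fun e => isClosed_eq (by fun_prop) (by fun_prop)
  · exact isClosed_iInter fun h => isClosed_le (by fun_prop) (by fun_prop)

/-- The evader can let her plan depend on her initial position. -/
theorem init_glue_mem_evaderPlans {c : V → History V N → ℝ} (hc : ∀ v, c v ∈ evaderPlans G N t) :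
    (fun h => c h.init h) ∈ evaderPlans G N t :=
  -- No constraint links histories with different initial vertices.
  ⟨⟨fun s => (hc s).1.1 s, fun h => (hc h.init).1.2.1 h, fun h => (hc h.init).1.2.2.1 h,
    fun h => (hc h.init).1.2.2.2.1 h, fun h => (hc h.init).1.2.2.2.2 h⟩,
    fun h => (hc h.1.init).2 h⟩

theorem EvaderStrategy.reach_nonneg (ρ : EvaderStrategy G N) (h : History V N) :
    0 ≤ ρ.reach h := by
  induction h with
  | start s => exact zero_le_one
  | round h p e ih => exact mul_nonneg ih ((ρ.prob_mem h).1 e)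

theorem EvaderStrategy.exists_plan (ρ : EvaderStrategy G N) (t : ℕ) :
    ∃ y ∈ evaderPlans G N t, ∀ h, h.rounds ≤ t → ρ.reach h = y h := by
  refine ⟨fun h => if h.rounds ≤ t then ρ.reach h else 0, ⟨⟨?_, ?_, ?_, ?_, ?_⟩, ?_⟩, ?_⟩
  · intro s
    simp [reach, History.rounds]
  · intro h hh
    simp [hh.not_ge]
  · intro h p hh
    simp [History.rounds, hh.le, Nat.succ_le_of_lt hh, reach, ← Finset.mul_sum, (ρ.prob_mem h).2]
  · intro h p e he
    simp [reach, ρ.legal h e he]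
  · intro h p q e
    simp [reach, History.rounds]
  · intro h
    simpa [h.2] using ρ.reach_nonneg h
  · intro h hh
    simp [hh]

theorem exists_evaderStrategy_of_plan (hG : ∀ v, ∃ w, G.Adj v w) (s₀ : Pos V N)
    {y : History V N → ℝ} (hy : y ∈ evaderPlans G N t) :
    ∃ ρ : EvaderStrategy G N, ∀ h, h.rounds ≤ t → ρ.reach h = y h := by
  -- `s₀` is just a reference value for the pursuer's simultaneous move, on which the plan does not
  -- depend.
  choose q hq hlegal hqy using fun h : History V N =>
    exists_stdSimplex_sum_mul_eq (m := fun e => y (.round h s₀ e))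
      (fun _ => evaderPlans_nonneg hy _) (evaderMoves_nonempty hG h.evaderPos)
      (hy.1.2.2.2.1 h s₀)
  refine ⟨⟨q, hq, hlegal⟩, fun h => ?_⟩
  induction h with
  | start s => exact fun _ => (hy.1.1 s).symm
  | round h p e ih =>
    intro hh
    rw [History.rounds] at hh
    rw [EvaderStrategy.reach, ih (by omega), ← hy.1.2.2.1 h s₀ (by omega),
      hy.1.2.2.2.2 h p s₀ e]
    exact hqy h e

/-! ### The payoff as a bilinear function of realization plans -/

open Classical in
/-- The pursuer's expected utility, as a bilinear function of the realization plans, when the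
evader starts in `v`. -/
noncomputable def planUtility (G : Digraph V) (γ : ℝ) (t : ℕ) (s₀ : Pos V N) (v : V) :
    (List (Pos V N) → ℝ) →ₗ[ℝ] (History V N → ℝ) →ₗ[ℝ] ℝ :=
  ∑ h ∈ (terminals G t s₀).filter (fun h => h.init = v),
    utility γ s₀ h • (LinearMap.mul ℝ ℝ).compl₁₂ (LinearMap.proj h.pursuerSeq) (LinearMap.proj h)

open Classical in
theorem planUtility_apply (γ : ℝ) (v : V) (x : List (Pos V N) → ℝ) (y : History V N → ℝ) :
    planUtility G γ t s₀ v x y = ∑ h ∈ (terminals G t s₀).filter (fun h => h.init = v),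
      utility γ s₀ h * (x h.pursuerSeq * y h) := by
  simp [planUtility]

theorem expectedUtility_eq_sum_planUtility (γ : ℝ) (b : V → ℝ) {σ : PursuerStrategy G s₀}
    {ρ : EvaderStrategy G N} {x : List (Pos V N) → ℝ} {y : History V N → ℝ}
    (hx : ∀ l, l.length ≤ t → σ.seqReach l = x l) (hy : ∀ h, h.rounds ≤ t → ρ.reach h = y h) :
    expectedUtility γ t b σ ρ = ∑ v, b v * planUtility G γ t s₀ v x y := by
  classical
  rw [expectedUtility, ← Finset.sum_fiberwise _ History.init]
  refine Finset.sum_congr rfl fun v _ => ?_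
  rw [planUtility_apply, Finset.mul_sum]
  refine Finset.sum_congr rfl fun h hh => ?_
  obtain ⟨hht, rfl⟩ := Finset.mem_filter.1 hh
  have hr := rounds_le_of_mem_terminals hht
  rw [σ.reach_eq_seqReach, hx _ (h.length_pursuerSeq.trans_le hr), hy _ hr]
  ring

end PursuitEvasion

/-! ### Transfer of the saddle points from plans to strategies. -/

open PursuitEvasion

theorem theorem1 {V : Type*} [Fintype V] (G : Digraph V)
    (hG : ∀ v, ∃ w, G.Adj v w) (N : ℕ) (γ : ℝ) (hγ0 : 0 ≤ γ) (hγ1 : γ < 1)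
    (t : ℕ) (s₀ : PursuitEvasion.Pos V N) :
    ∃ S : Set (PursuitEvasion.PursuerStrategy G s₀), S.Finite ∧
      ∀ b ∈ stdSimplex ℝ V, ∃ σ ∈ S, ∃ ρ : PursuitEvasion.EvaderStrategy G N,
        PursuitEvasion.IsNash γ t b σ ρ := by
  classical
  obtain ⟨x₀, hx₀, -⟩ := (nonempty_pursuerStrategy hG s₀).some.exists_plan t
  obtain ⟨y₀, hy₀, -⟩ := (nonempty_evaderStrategy (N := N) hG).some.exists_plan t
  have : Finite {l : List (Pos V N) // l.length ≤ t} := List.finite_length_le _ t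
  have : Finite {h : History V N // h.rounds ≤ t} := History.finite_rounds_le t
  obtain ⟨S, hS, hSfin, hsaddle⟩ := exists_finite_isSaddlePointOn
    (pursuerPlanSpace G t s₀) _ isCompact_pursuerPlans ⟨x₀, hx₀⟩
    (evaderPlanSpace G N t) _ isCompact_evaderPlans ⟨y₀, hy₀⟩
    (planUtility G γ t s₀)
    (fun v x => by simp only [planUtility_apply]; fun_prop)
    (fun v y => by simp only [planUtility_apply]; fun_prop)
    -- The payoff for `v` only involves histories starting in `v`, where the glued plan equals `c
    -- v`.
    (fun c hc => ⟨_, init_glue_mem_evaderPlans hc, fun v x => by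
      simp only [planUtility_apply]
      refine Finset.sum_congr rfl fun h hh => ?_
      rw [(Finset.mem_filter.1 hh).2]⟩)
  choose f hf using fun x : S => exists_pursuerStrategy_of_plan hG (hS x.2)
  have : Finite S := hSfin
  refine ⟨Set.range f, Set.finite_range f, fun b hb => ?_⟩
  obtain ⟨x, hx, y, hy, hxmax, hymin⟩ := hsaddle b hb.1
  obtain ⟨ρ, hρ⟩ := exists_evaderStrategy_of_plan hG s₀ hy
  refine ⟨f ⟨x, hx⟩, ⟨_, rfl⟩, ρ, fun σ' => ?_, fun ρ' => ?_⟩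
  · obtain ⟨x', hx', hσ'⟩ := σ'.exists_plan t
    rw [expectedUtility_eq_sum_planUtility γ b hσ' hρ,
      expectedUtility_eq_sum_planUtility γ b (hf ⟨x, hx⟩) hρ]
    exact hxmax x' hx'
  · obtain ⟨y', hy', hρ'⟩ := ρ'.exists_plan t
    rw [expectedUtility_eq_sum_planUtility γ b (hf ⟨x, hx⟩) hρ,
      expectedUtility_eq_sum_planUtility γ b (hf ⟨x, hx⟩) hρ']
    exact hymin y' hy'
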